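/- **Theorem (Free-Support Fused Barycenter).** Let $A\subset\mathbb R^d$ be convex and compact, with the Euclidean distance $e(a,a')=\|a-a'\|$. A *labelled mm-space* $\mathfrak X=(X\times A,d,e,\mu)$ consists of a compact metric space $(X,d)$ and a Borel probability measure $\mu$ on $X\times A$. For $\beta\in[0,1]$, let $\mathrm{FGW}_\beta(\mathfrak X_1,\mathfrak X_2)$ be the infimum, over all couplings $\pi$ of $\mu_1$ and $\mu_2$, of $$\Bigl(\iint (1-\beta)\,|d_1(x_1,x_1')-d_2(x_2,x_2')|^2+\tfrac\beta2 e(a_1,a_2)^2+\tfrac\beta2 e(a_1',a_2')^2\,\mathrm d\pi((x_1,a_1),(x_2,a_2))\,\mathrm d\pi((x_1',a_1'),(x_2',a_2'))\Bigr)^{1/2}.$$ Two labelled mm-spaces $(X\times A,d_X,e,\mu)$ and $(Y\times A,d_Y,e,\nu)$ are *isomorphic* if there is a bijective isometry $\mathcal I$ from the support of the marginal of $\mu$ on $X$ onto the support of the marginal of $\nu$ on $Y$ such that $(x,a)\mapsto(\mathcal I(x),a)$ pushes $\mu$ forward to $\nu$. Let $\mathfrak X_i=(X_i\times A,d_i,e,\mu_i)$,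 $i=1,\dots,N$, be labelled mm-spaces, and let $\rho_i\ge 0$ with $\sum_{i=1}^N\rho_i=1$. Consider the fused Gromov–Wasserstein barycenter problem $$\inf_{\mathfrak Y}\ \sum_{i=1}^N\rho_i\,\mathrm{FGW}_\beta^2(\mathfrak X_i,\mathfrak Y),\tag{B}$$ where $\mathfrak Y$ ranges over all labelled mm-spaces with label space $(A,e)$. Put $\boldsymbol X=X_1\times\dots\times X_N$, $d^*(\boldsymbol x,\boldsymbol x')=\sum_i\rho_i d_i(x_i,x_i')$ and $m_\rho(\boldsymbol a)=\sum_i\rho_i a_i$. For a Borel probability measure $\pi$ on $\prod_i (X_i\times A)$, let $$\mathfrak Y_\pi=(\boldsymbol X\times A,\,d^*,\,e,\,(P_{\boldsymbol X},m_\rho)_\#\pi),\qquad (P_{\boldsymbol X},m_\rho)(\boldsymbol x,\boldsymbol a)=(\boldsymbol x,m_\rho(\boldsymbol a)),$$ where points of $\boldsymbol X$ at $d^*$-distance $0$ are identified (this identifies nothing if all $\rho_i>0$). Then: 1. For every $\beta\in[0,1]$, the infimum in (B) is attained. 2. For every $\beta\in[0,1]$ and every solution $\mathfrak Y$ of (B),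 there is a minimizer $\pi^*$ of $$\mathrm{MFGW}_\beta(\mathfrak X_1,\dots,\mathfrak X_N)=\inf_{\pi}\iint (1-\beta)\,c_{\mathrm{mm}}(\boldsymbol x,\boldsymbol x')+\tfrac\beta2 c_{\mathrm{lb}}(\boldsymbol a)+\tfrac\beta2 c_{\mathrm{lb}}(\boldsymbol a')\,\mathrm d\pi(\boldsymbol x,\boldsymbol a)\,\mathrm d\pi(\boldsymbol x',\boldsymbol a'),$$ where $\pi$ ranges over the Borel probability measures on $\prod_i(X_i\times A)$ with marginals $\mu_1,\dots,\mu_N$, and $$c_{\mathrm{mm}}(\boldsymbol x,\boldsymbol x')=\tfrac12\sum_{i,j=1}^N\rho_i\rho_j|d_i(x_i,x_i')-d_j(x_j,x_j')|^2,\qquad c_{\mathrm{lb}}(\boldsymbol a)=\tfrac12\sum_{i,j=1}^N\rho_i\rho_j\|a_i-a_j\|^2,$$ such that $\mathrm{FGW}_\beta(\mathfrak Y,\mathfrak Y_{\pi^*})=0$ and, if $0<\beta<1$, $\mathfrak Y$ is isomorphic to $\mathfrak Y_{\pi^*}$. -/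

import Mathlib

open MeasureTheory
open scoped BigOperators

universe u v

/-- A labelled mm-space `(X × A, d, e, μ)` over the label space `A`: a compact metric structure
space `X` with its Borel σ-algebra, and a Borel probability measure `μ` on `X × A`.
Compactness of the label space is a hypothesis wherever it is needed. -/
structure LabelledMMSpace (A : Type v) [MetricSpace A] [MeasurableSpace A] [BorelSpace A] where
  /-- the structure space -/
  carrier : Type u
  [instMetric : MetricSpace carrier]
  [instCompact : CompactSpace carrier]
  [instMeasurable : MeasurableSpace carrier]
  [instBorel : BorelSpace carrier]
  /-- the measure on the labelled space -/
  μ : Measure (carrier × A)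
  [instProb : IsProbabilityMeasure μ]

namespace LabelledMMSpace

attribute [instance] instMetric instCompact instMeasurable instBorel instProb

section General

variable {A : Type v} [MetricSpace A] [MeasurableSpace A] [BorelSpace A]

/-- The set `Π(μ₁, μ₂)` of transport plans between two labelled mm-spaces. -/
def couplings (𝔛 𝔜 : LabelledMMSpace.{u} A) :
    Set (Measure ((𝔛.carrier × A) × (𝔜.carrier × A))) :=
  {π | IsProbabilityMeasure π ∧ π.map Prod.fst = 𝔛.μ ∧ π.map Prod.snd = 𝔜.μ}

/-- The fused Gromov--Wasserstein functional
`∬ (1-β)|d₁(x₁,x₁') - d₂(x₂,x₂')|² + β/2 e(a₁,a₂)² + β/2 e(a₁',a₂')² dπ dπ`. -/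
noncomputable def fgwCost (β : ℝ) (𝔛 𝔜 : LabelledMMSpace.{u} A)
    (π : Measure ((𝔛.carrier × A) × (𝔜.carrier × A))) : ℝ :=
  ∫ p : ((𝔛.carrier × A) × (𝔜.carrier × A)) × ((𝔛.carrier × A) × (𝔜.carrier × A)),
    ((1 - β) * |dist p.1.1.1 p.2.1.1 - dist p.1.2.1 p.2.2.1| ^ 2
      + β / 2 * dist p.1.1.2 p.1.2.2 ^ 2
      + β / 2 * dist p.2.1.2 p.2.2.2 ^ 2) ∂(π.prod π)

/-- The fused Gromov--Wasserstein distance `FGW_β`. -/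
noncomputable def FGW (β : ℝ) (𝔛 𝔜 : LabelledMMSpace.{u} A) : ℝ :=
  ⨅ π : couplings 𝔛 𝔜, Real.sqrt (fgwCost β 𝔛 𝔜 π)

/-- The support of the structure marginal `(P_X)_# μ`, i.e. the part of the structure space that
is seen by the measure. -/
def structSupport (𝔛 : LabelledMMSpace.{u} A) : Set 𝔛.carrier :=
  (𝔛.μ.map Prod.fst).support

/-- The measure `μ`, viewed on `supp((P_X)_# μ) × A`, a set of full measure. -/
noncomputable def suppMeasure (𝔛 : LabelledMMSpace.{u} A) : Measure (𝔛.structSupport × A) :=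
  𝔛.μ.comap (Prod.map Subtype.val id)

/-- Isomorphism of labelled mm-spaces: a measure preserving map `(x, a) ↦ (I x, a)`, where `I` is
an isometry of the structure spaces and the labels are fixed. Spaces need not have full
support, and points outside the support are disregarded, as usual for mm-spaces. -/
def Isomorphic (𝔛 𝔜 : LabelledMMSpace.{u} A) : Prop :=
  ∃ I : 𝔛.structSupport ≃ᵢ 𝔜.structSupport,
    𝔛.suppMeasure.map (Prod.map I id) = 𝔜.suppMeasure

variable {N : ℕ}

/-- The objective `∑ i, ρ_i FGW_β(𝔛_i, 𝔜)²` of the barycenter problem. -/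
noncomputable def barycenterObjective (β : ℝ) (ρ : Fin N → ℝ)
    (𝔛 : Fin N → LabelledMMSpace.{u} A) (𝔜 : LabelledMMSpace.{u} A) : ℝ :=
  ∑ i, ρ i * FGW β (𝔛 i) 𝔜 ^ 2

/-- `𝔜` is a fused Gromov--Wasserstein barycenter of the `𝔛_i` with weights `ρ`: it minimizes the
objective among all labelled mm-spaces over `A`. -/
def IsFusedBarycenter (β : ℝ) (ρ : Fin N → ℝ)
    (𝔛 : Fin N → LabelledMMSpace.{u} A) (𝔜 : LabelledMMSpace.{u} A) : Prop :=
  ∀ 𝔷 : LabelledMMSpace.{u} A, barycenterObjective β ρ 𝔛 𝔜 ≤ barycenterObjective β ρ 𝔛 𝔷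

/-- The set `Π(μ₁, …, μ_N)` of multi-marginal transport plans. -/
def multiCouplings (𝔛 : Fin N → LabelledMMSpace.{u} A) :
    Set (Measure (∀ i, (𝔛 i).carrier × A)) :=
  {π | IsProbabilityMeasure π ∧ ∀ i, π.map (fun z => z i) = (𝔛 i).μ}

/-- The objective of the multi-marginal fused Gromov--Wasserstein problem `MFGW_β` with structure
cost `c_mm` and label cost `c_lb`. -/
noncomputable def mfgwCost (β : ℝ) (𝔛 : Fin N → LabelledMMSpace.{u} A)
    (cmm : (∀ i, (𝔛 i).carrier) → (∀ i, (𝔛 i).carrier) → ℝ) (clb : (Fin N → A) → ℝ)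
    (π : Measure (∀ i, (𝔛 i).carrier × A)) : ℝ :=
  ∫ p : (∀ i, (𝔛 i).carrier × A) × (∀ i, (𝔛 i).carrier × A),
    ((1 - β) * cmm (fun i => (p.1 i).1) (fun i => (p.2 i).1)
      + β / 2 * clb (fun i => (p.1 i).2)
      + β / 2 * clb (fun i => (p.2 i).2)) ∂(π.prod π)

/-- `π` is a minimizer of `MFGW_β(𝔛₁, …, 𝔛_N)` with costs `c_mm` and `c_lb`. -/
def IsMFGWMinimizer (β : ℝ) (𝔛 : Fin N → LabelledMMSpace.{u} A)
    (cmm : (∀ i, (𝔛 i).carrier) → (∀ i, (𝔛 i).carrier) → ℝ) (clb : (Fin N → A) → ℝ)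
    (π : Measure (∀ i, (𝔛 i).carrier × A)) : Prop :=
  π ∈ multiCouplings 𝔛 ∧ IsMinOn (mfgwCost β 𝔛 cmm clb) (multiCouplings 𝔛) π

/-- The structure cost `½ ∑ i j, ρ_i ρ_j |d_i(x_i, x_i') - d_j(x_j, x_j')|²`. -/
noncomputable def structCost (ρ : Fin N → ℝ) (𝔛 : Fin N → LabelledMMSpace.{u} A)
    (x x' : ∀ i, (𝔛 i).carrier) : ℝ :=
  1 / 2 * ∑ i, ∑ j, ρ i * ρ j * |dist (x i) (x' i) - dist (x j) (x' j)| ^ 2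

end General

end LabelledMMSpace

/-- The product `X₁ × ⋯ × X_N`, to be equipped with `d*(x, x') = ∑ i, ρ_i d_i(x_i, x_i')`. -/
def WeightedProd {N : ℕ} {ρ : Fin N → ℝ} (_hρ : ∀ i, 0 ≤ ρ i) (X : Fin N → Type u) : Type u :=
  ∀ i, X i

namespace WeightedProd

variable {N : ℕ} {ρ : Fin N → ℝ} {hρ : ∀ i, 0 ≤ ρ i} {X : Fin N → Type u}

/-- The identity map from the product. -/
def of (hρ : ∀ i, 0 ≤ ρ i) (x : ∀ i, X i) : WeightedProd hρ X := x

/-- `d*(x, x') = ∑ i, ρ_i d_i(x_i, x_i')`; it is a metric if all weights are positive, and only a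
pseudometric if some weight vanishes. -/
noncomputable instance instPseudoMetricSpace [∀ i, MetricSpace (X i)] :
    PseudoMetricSpace (WeightedProd hρ X) where
  dist x x' := ∑ i, ρ i * dist (x i) (x' i)
  dist_self x := by simp
  dist_comm x y := by simp [dist_comm]
  dist_triangle x y z := by
    rw [← Finset.sum_add_distrib]
    refine Finset.sum_le_sum fun i _ => ?_
    rw [← mul_add]
    exact mul_le_mul_of_nonneg_left (dist_triangle _ _ _) (hρ i)

theorem dist_of [∀ i, MetricSpace (X i)] (x x' : ∀ i, X i) :
    dist (of hρ x) (of hρ x') = ∑ i, ρ i * dist (x i) (x' i) := rfl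

theorem continuous_of [∀ i, MetricSpace (X i)] :
    Continuous (of hρ : (∀ i, X i) → WeightedProd hρ X) := by
  rw [continuous_iff_continuousAt]
  intro x
  rw [ContinuousAt, tendsto_iff_dist_tendsto_zero]
  have h : Continuous fun y : ∀ i, X i => ∑ i, ρ i * dist (y i) (x i) := by fun_prop
  have h0 := h.tendsto x
  simpa [dist_of] using h0

instance instCompactSpace [∀ i, MetricSpace (X i)] [∀ i, CompactSpace (X i)] :
    CompactSpace (WeightedProd hρ X) := by
  refine ⟨?_⟩
  have h := isCompact_range (continuous_of (hρ := hρ) (X := X))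
  have hs : Function.Surjective (of hρ : (∀ i, X i) → WeightedProd hρ X) := fun x => ⟨x, rfl⟩
  rwa [hs.range_eq] at h

end WeightedProd

/-- The metric space `(X₁ × ⋯ × X_N, d*)`, where points at `d*`-distance zero are identified (which
changes nothing if all weights are positive). -/
abbrev MeanSpace {N : ℕ} {ρ : Fin N → ℝ} (hρ : ∀ i, 0 ≤ ρ i) (X : Fin N → Type u)
    [∀ i, MetricSpace (X i)] : Type u :=
  SeparationQuotient (WeightedProd hρ X)

namespace MeanSpace

variable {N : ℕ} {ρ : Fin N → ℝ} {hρ : ∀ i, 0 ≤ ρ i} {X : Fin N → Type u}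
  [∀ i, MetricSpace (X i)]

noncomputable instance instMeasurableSpace : MeasurableSpace (MeanSpace hρ X) := borel _

instance instBorelSpace : BorelSpace (MeanSpace hρ X) := ⟨rfl⟩

instance instCompactSpace [∀ i, CompactSpace (X i)] : CompactSpace (MeanSpace hρ X) := by
  refine ⟨?_⟩
  have h := isCompact_range (SeparationQuotient.continuous_mk (X := WeightedProd hρ X))
  rwa [SeparationQuotient.range_mk] at h

/-- The canonical map from the product. -/
noncomputable def mk (hρ : ∀ i, 0 ≤ ρ i) (x : ∀ i, X i) : MeanSpace hρ X :=
  SeparationQuotient.mk (WeightedProd.of hρ x)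

theorem dist_mk (x x' : ∀ i, X i) :
    dist (mk hρ x) (mk hρ x') = ∑ i, ρ i * dist (x i) (x' i) := rfl

theorem continuous_mk : Continuous (mk hρ : (∀ i, X i) → MeanSpace hρ X) :=
  SeparationQuotient.continuous_mk.comp WeightedProd.continuous_of

end MeanSpace

namespace LabelledMMSpace

section Euclidean

variable {d N : ℕ} {A : Set (EuclideanSpace ℝ (Fin d))}

/-- The label cost `½ ∑ i j, ρ_i ρ_j ‖a_i - a_j‖²`. -/
noncomputable def labelCost (ρ : Fin N → ℝ) (a : Fin N → A) : ℝ :=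
  1 / 2 * ∑ i, ∑ j, ρ i * ρ j *
    ‖(a i : EuclideanSpace ℝ (Fin d)) - (a j : EuclideanSpace ℝ (Fin d))‖ ^ 2

/-- The weighted mean `m_ρ(a) = ∑ i, ρ_i a_i`, which stays in the convex set `A`. -/
noncomputable def labelMean {ρ : Fin N → ℝ} (hA : Convex ℝ A) (hρ : ∀ i, 0 ≤ ρ i)
    (hsum : ∑ i, ρ i = 1) (a : Fin N → A) : A :=
  ⟨∑ i, ρ i • (a i : EuclideanSpace ℝ (Fin d)),
    hA.sum_mem (fun i _ => hρ i) hsum (fun i _ => (a i).2)⟩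

/-- The map `(P_X, m_ρ) : (x, a) ↦ (x, m_ρ(a))`. -/
noncomputable def meanMap {ρ : Fin N → ℝ} (hA : Convex ℝ A) (hρ : ∀ i, 0 ≤ ρ i)
    (hsum : ∑ i, ρ i = 1) (𝔛 : Fin N → LabelledMMSpace.{u} A)
    (z : ∀ i, (𝔛 i).carrier × A) : MeanSpace hρ (fun i => (𝔛 i).carrier) × A :=
  (MeanSpace.mk hρ (fun i => (z i).1), labelMean hA hρ hsum (fun i => (z i).2))

theorem measurable_meanMap {ρ : Fin N → ℝ} (hA : Convex ℝ A) (hρ : ∀ i, 0 ≤ ρ i)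
    (hsum : ∑ i, ρ i = 1) (𝔛 : Fin N → LabelledMMSpace.{u} A) :
    Measurable (meanMap hA hρ hsum 𝔛) := by
  refine Measurable.prodMk ?_ ?_
  · exact MeanSpace.continuous_mk.measurable.comp (by fun_prop)
  · refine Measurable.subtype_mk ?_
    fun_prop

/-- The labelled mm-space `(X₁ × ⋯ × X_N × A, d*, e, (P_X, m_ρ)_# π)`. -/
noncomputable def meanLabelledSpace {ρ : Fin N → ℝ} (hA : Convex ℝ A) (hρ : ∀ i, 0 ≤ ρ i)
    (hsum : ∑ i, ρ i = 1) (𝔛 : Fin N → LabelledMMSpace.{u} A)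
    (π : Measure (∀ i, (𝔛 i).carrier × A)) [IsProbabilityMeasure π] :
    LabelledMMSpace.{u} A where
  carrier := MeanSpace hρ (fun i => (𝔛 i).carrier)
  μ := π.map (meanMap hA hρ hsum 𝔛)
  instProb := Measure.isProbabilityMeasure_map (measurable_meanMap hA hρ hsum 𝔛).aemeasurable

end Euclidean

end LabelledMMSpace

/-! The core is a variance decomposition: for weights summing to one, a weighted mean of squared
distances to a point is the weighted pairwise variance plus the squared distance to the weighted
mean (`sum_mul_norm_sub_sq_eq`). Applied to the numbers `d_i(x_i, x_i')` and to the labels, it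
splits the averaged FGW integrand into the multi-marginal integrand plus the FGW integrand between
`𝔜` and a mean space.

Given any `𝔜`, gluing optimal plans along `𝔜` therefore writes its objective as the multi-marginal
cost of some plan `π` plus a nonnegative remainder, the cost of a coupling of `𝔜` with `𝔜_π`
(`exists_barycenterObjective_eq`). Conversely, coupling `𝔜_π` to the `𝔛_i` through `π` itself leaves
no remainder, so its objective is at most the cost of `π`
(`barycenterObjective_meanLabelledSpace_le`). A minimizing plan, which exists by weak compactness,
thus yields a barycenter, and for any barycenter the remainder vanishes. If `0 < β < 1`, a coupling
of zero cost is carried by the graph of an isomorphism. -/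

/-! ### Gluing of couplings -/

/-- Couplings `σ i` of `X i` and `Z` with common second marginal can be glued along `Z`. -/
theorem MeasureTheory.Measure.exists_glue {ι : Type*} {Z : Type*} {X : ι → Type*}
    [MeasurableSpace Z] [∀ i, MeasurableSpace (X i)] [∀ i, StandardBorelSpace (X i)]
    [∀ i, Nonempty (X i)] (ν : Measure Z) [IsProbabilityMeasure ν]
    (σ : ∀ i, Measure (X i × Z)) [∀ i, IsProbabilityMeasure (σ i)]
    (hσ : ∀ i, (σ i).map Prod.snd = ν) :
    ∃ γ : Measure ((∀ i, X i) × Z), IsProbabilityMeasure γ ∧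
      ∀ i, γ.map (fun p => (p.1 i, p.2)) = σ i := by
  -- Randomization: the conditional law of `σ i` given `z` is the image of the uniform law on
  -- `[0,1]` under `f z`.
  have key : ∀ i, ∃ f : Z → unitInterval → X i, Measurable (Function.uncurry f) ∧
      (ν.prod volume).map (fun q => (f q.1 q.2, q.1)) = σ i := by
    intro i
    set τ := (σ i).map Prod.swap with hτ
    have : IsProbabilityMeasure τ := Measure.isProbabilityMeasure_map (by fun_prop)
    have hfst : τ.fst = ν := by
      rw [Measure.fst, hτ, Measure.map_map measurable_fst measurable_swap]
      exact hσ i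
    obtain ⟨f, hf, hfκ⟩ :=
      ProbabilityTheory.Kernel.exists_measurable_map_eq_unitInterval τ.condKernel
    refine ⟨f, hf, ?_⟩
    have hm : Measurable fun q : Z × unitInterval => (q.1, f q.1 q.2) :=
      measurable_fst.prodMk hf
    have h1 : (ν.prod volume).map (fun q : Z × unitInterval => (q.1, f q.1 q.2)) = τ := by
      rw [← τ.disintegrate τ.condKernel, hfst]
      ext s hs
      rw [Measure.map_apply hm hs, Measure.prod_apply (hm hs), Measure.compProd_apply hs]
      refine lintegral_congr fun z => ?_
      rw [← hfκ z, Measure.map_apply hf.of_uncurry_left (measurable_prodMk_left hs)]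
      rfl
    have h2 : σ i = τ.map Prod.swap := by
      rw [hτ, Measure.map_map measurable_swap measurable_swap, Prod.swap_swap_eq, Measure.map_id]
    rw [h2, ← h1, Measure.map_map measurable_swap hm]
    rfl
  choose f hf hfσ using key
  -- One uniform variable drives all coordinates: only each pair with `z` is prescribed, so their
  -- joint conditional law is free.
  have hm : Measurable fun q : Z × unitInterval => ((fun i => f i q.1 q.2 : ∀ i, X i), q.1) :=
    (measurable_pi_lambda _ fun i => hf i).prodMk measurable_fst
  refine ⟨(ν.prod volume).map _, Measure.isProbabilityMeasure_map hm.aemeasurable, fun i => ?_⟩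
  rw [Measure.map_map (by fun_prop) hm, ← hfσ i]
  rfl

/-! ### Weak compactness and closed marginal constraints -/

/-- On a compact metric space, `π ↦ ∬ F dπ dπ` with continuous `F` attains its minimum on every
nonempty weakly closed set of probability measures. -/
theorem MeasureTheory.exists_isMinOn_integral_prod_self {E : Type*} [MetricSpace E]
    [CompactSpace E] [MeasurableSpace E] [BorelSpace E] {F : E × E → ℝ} (hF : Continuous F)
    {C : Set (Measure E)} (hprob : ∀ π ∈ C, IsProbabilityMeasure π)
    (hC : IsClosed {P : ProbabilityMeasure E | (P : Measure E) ∈ C}) (hne : C.Nonempty) :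
    ∃ π ∈ C, IsMinOn (fun π : Measure E => ∫ p, F p ∂(π.prod π)) C π := by
  have hcont : Continuous fun P : ProbabilityMeasure E =>
      ∫ p, F p ∂((P : Measure E).prod (P : Measure E)) := by
    -- The functional is quadratic in `P` but linear in `P ⊗ P`, which depends weakly continuously
    -- on `P`.
    have h1 : Continuous fun P : ProbabilityMeasure E => P.prod P := by fun_prop
    exact (ProbabilityMeasure.continuous_integral_continuousMap (⟨F, hF⟩ : C(E × E, ℝ))).comp h1
  obtain ⟨π₀, h₀⟩ := hne
  have := hprob π₀ h₀
  obtain ⟨P, hP, hmin⟩ := hC.isCompact.exists_isMinOn ⟨(⟨π₀, this⟩ : ProbabilityMeasure E), h₀⟩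
    hcont.continuousOn
  exact ⟨P, hP, fun π hπ => hmin (a := ⟨π, hprob π hπ⟩) hπ⟩

/-- Pushforward along a continuous map is weakly continuous, so each marginal constraint is closed;
sets of plans are intersections of these. -/
theorem MeasureTheory.ProbabilityMeasure.isClosed_setOf_map_eq {E E' : Type*}
    [MetricSpace E] [MeasurableSpace E] [BorelSpace E]
    [MetricSpace E'] [MeasurableSpace E'] [BorelSpace E'] {f : E → E'}
    (hf : Continuous f) (m : Measure E') [IsProbabilityMeasure m] :
    IsClosed {P : ProbabilityMeasure E | (P : Measure E).map f = m} := by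
  let M : ProbabilityMeasure E' := ⟨m, inferInstance⟩
  have h : IsClosed {P : ProbabilityMeasure E | P.map hf.measurable.aemeasurable = M} :=
    isClosed_eq (ProbabilityMeasure.continuous_map hf) continuous_const
  convert h using 3 with P
  rw [← ProbabilityMeasure.toMeasure_injective.eq_iff, ProbabilityMeasure.toMeasure_map]
  rfl

/-! ### The variance identity -/

/-- The mean minimizes the weighted sum of squared distances; the excess is explicit. -/
theorem sum_mul_norm_sub_sq_eq {ι V : Type*} [Fintype ι] [NormedAddCommGroup V]
    [InnerProductSpace ℝ V] {ρ : ι → ℝ} (hsum : ∑ i, ρ i = 1) (t : ι → V) (s : V) :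
    ∑ i, ρ i * ‖t i - s‖ ^ 2
      = 1 / 2 * ∑ i, ∑ j, ρ i * ρ j * ‖t i - t j‖ ^ 2 + ‖s - ∑ i, ρ i • t i‖ ^ 2 := by
  set S := ∑ i, ρ i * ‖t i‖ ^ 2
  set m := ∑ i, ρ i • t i with hm
  have hinner : ∀ w : V, ∑ i, ρ i * inner ℝ (t i) w = inner ℝ m w := by
    intro w
    simp [hm, sum_inner, real_inner_smul_left]
  have h1 : ∑ i, ρ i * ‖t i - s‖ ^ 2 = S - 2 * inner ℝ m s + ‖s‖ ^ 2 := by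
    have : ∀ i, ρ i * ‖t i - s‖ ^ 2
        = ρ i * ‖t i‖ ^ 2 - 2 * (ρ i * inner ℝ (t i) s) + ρ i * ‖s‖ ^ 2 := by
      intro i; rw [norm_sub_sq_real]; ring
    simp_rw [this, Finset.sum_add_distrib, Finset.sum_sub_distrib, ← Finset.mul_sum,
      ← Finset.sum_mul, hsum, hinner]
    ring
  have h2 : ∑ i, ∑ j, ρ i * ρ j * ‖t i - t j‖ ^ 2 = 2 * S - 2 * ‖m‖ ^ 2 := by
    have : ∀ i j, ρ i * ρ j * ‖t i - t j‖ ^ 2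
        = ρ j * (ρ i * ‖t i‖ ^ 2) - 2 * (ρ i * (ρ j * inner ℝ (t j) (t i)))
          + ρ i * (ρ j * ‖t j‖ ^ 2) := by
      intro i j; rw [norm_sub_sq_real, real_inner_comm]; ring
    simp_rw [this, Finset.sum_add_distrib, Finset.sum_sub_distrib, ← Finset.mul_sum,
      ← Finset.sum_mul, hsum, hinner]
    have h3 : ∑ i, ρ i * inner ℝ m (t i) = ‖m‖ ^ 2 := by
      simp_rw [real_inner_comm _ m]
      rw [hinner, real_inner_self_eq_norm_sq]
    rw [h3]
    simp only [← Finset.mul_sum]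
    ring
  rw [h1, h2, norm_sub_sq_real, real_inner_comm]
  ring

/-! ### Existence of optimal FGW plans -/

namespace LabelledMMSpace

section Attainment

variable {A : Type v} [MetricSpace A] [MeasurableSpace A] [BorelSpace A]

theorem prod_mem_couplings (𝔛 𝔜 : LabelledMMSpace.{u} A) : 𝔛.μ.prod 𝔜.μ ∈ couplings 𝔛 𝔜 := by
  refine ⟨inferInstance, ?_, ?_⟩ <;> simp

/-- The integrand of the fused Gromov--Wasserstein functional. -/
noncomputable def fgwIntegrand (β : ℝ) (𝔛 𝔜 : LabelledMMSpace.{u} A)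
    (p : ((𝔛.carrier × A) × (𝔜.carrier × A)) × ((𝔛.carrier × A) × (𝔜.carrier × A))) : ℝ :=
  (1 - β) * |dist p.1.1.1 p.2.1.1 - dist p.1.2.1 p.2.2.1| ^ 2
    + β / 2 * dist p.1.1.2 p.1.2.2 ^ 2 + β / 2 * dist p.2.1.2 p.2.2.2 ^ 2

theorem continuous_fgwIntegrand (β : ℝ) (𝔛 𝔜 : LabelledMMSpace.{u} A) :
    Continuous (fgwIntegrand β 𝔛 𝔜) := by
  unfold fgwIntegrand
  fun_prop

theorem fgwCost_eq (β : ℝ) (𝔛 𝔜 : LabelledMMSpace.{u} A)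
    (π : Measure ((𝔛.carrier × A) × (𝔜.carrier × A))) :
    fgwCost β 𝔛 𝔜 π = ∫ p, fgwIntegrand β 𝔛 𝔜 p ∂(π.prod π) := rfl

variable {β : ℝ}

theorem fgwIntegrand_nonneg (hβ0 : 0 ≤ β) (hβ1 : β ≤ 1) (𝔛 𝔜 : LabelledMMSpace.{u} A)
    (p : ((𝔛.carrier × A) × (𝔜.carrier × A)) × ((𝔛.carrier × A) × (𝔜.carrier × A))) :
    0 ≤ fgwIntegrand β 𝔛 𝔜 p := by
  have : 0 ≤ 1 - β := by linarith
  unfold fgwIntegrand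
  positivity

theorem fgwCost_nonneg (hβ0 : 0 ≤ β) (hβ1 : β ≤ 1) (𝔛 𝔜 : LabelledMMSpace.{u} A)
    (π : Measure ((𝔛.carrier × A) × (𝔜.carrier × A))) : 0 ≤ fgwCost β 𝔛 𝔜 π :=
  integral_nonneg (fgwIntegrand_nonneg hβ0 hβ1 𝔛 𝔜)

theorem FGW_nonneg (β : ℝ) (𝔛 𝔜 : LabelledMMSpace.{u} A) : 0 ≤ FGW β 𝔛 𝔜 :=
  Real.iInf_nonneg fun _ => Real.sqrt_nonneg _

/-- The bounds on `β` make the cost nonnegative, so squaring undoes the square root. -/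
theorem FGW_sq_le_fgwCost (hβ0 : 0 ≤ β) (hβ1 : β ≤ 1) {𝔛 𝔜 : LabelledMMSpace.{u} A}
    {π : Measure ((𝔛.carrier × A) × (𝔜.carrier × A))} (hπ : π ∈ couplings 𝔛 𝔜) :
    FGW β 𝔛 𝔜 ^ 2 ≤ fgwCost β 𝔛 𝔜 π := by
  have h : FGW β 𝔛 𝔜 ≤ Real.sqrt (fgwCost β 𝔛 𝔜 π) :=
    ciInf_le (f := fun π : couplings 𝔛 𝔜 => Real.sqrt (fgwCost β 𝔛 𝔜 π))
      ⟨0, by rintro _ ⟨π, rfl⟩; exact Real.sqrt_nonneg _⟩ ⟨π, hπ⟩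
  calc FGW β 𝔛 𝔜 ^ 2 ≤ Real.sqrt (fgwCost β 𝔛 𝔜 π) ^ 2 := by
        gcongr
        exact FGW_nonneg β 𝔛 𝔜
    _ = _ := Real.sq_sqrt (fgwCost_nonneg hβ0 hβ1 𝔛 𝔜 π)

/-- Optimal plans exist. -/
theorem exists_mem_couplings_fgwCost_eq [CompactSpace A] (hβ0 : 0 ≤ β) (hβ1 : β ≤ 1)
    (𝔛 𝔜 : LabelledMMSpace.{u} A) :
    ∃ π ∈ couplings 𝔛 𝔜, fgwCost β 𝔛 𝔜 π = FGW β 𝔛 𝔜 ^ 2 := by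
  have hclosed : IsClosed {P : ProbabilityMeasure ((𝔛.carrier × A) × (𝔜.carrier × A)) |
      (P : Measure _) ∈ couplings 𝔛 𝔜} := by
    have h := (ProbabilityMeasure.isClosed_setOf_map_eq continuous_fst 𝔛.μ).inter
      (ProbabilityMeasure.isClosed_setOf_map_eq
        (E := (𝔛.carrier × A) × (𝔜.carrier × A)) continuous_snd 𝔜.μ)
    convert h using 1
    ext P
    exact ⟨fun hP => hP.2, fun hP => ⟨inferInstance, hP⟩⟩
  obtain ⟨π, hπ, hmin⟩ := exists_isMinOn_integral_prod_self (continuous_fgwIntegrand β 𝔛 𝔜)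
    (fun π hπ => hπ.1) hclosed ⟨_, prod_mem_couplings 𝔛 𝔜⟩
  refine ⟨π, hπ, le_antisymm ?_ (FGW_sq_le_fgwCost hβ0 hβ1 hπ)⟩
  have h : Real.sqrt (fgwCost β 𝔛 𝔜 π) ≤ FGW β 𝔛 𝔜 := by
    have : Nonempty (couplings 𝔛 𝔜) := ⟨⟨π, hπ⟩⟩
    exact le_ciInf fun π' => Real.sqrt_le_sqrt (hmin π'.2)
  exact (Real.sqrt_le_left (FGW_nonneg β 𝔛 𝔜)).1 h

end Attainment

/-! ### Couplings of zero cost and isomorphisms -/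

section Isomorphism

variable {A : Type v} [MetricSpace A] [MeasurableSpace A] [BorelSpace A]

/-- If `f = 0` almost everywhere for `θ ⊗ θ`, then `f = 0` on `supp θ × supp θ`. -/
theorem eq_zero_of_mem_support_prod {E : Type*} [TopologicalSpace E] [MeasurableSpace E]
    {θ : Measure E} [SFinite θ] {f : E × E → ℝ}
    (hf : Continuous f) (h0 : ∀ᵐ p ∂(θ.prod θ), f p = 0) {a b : E} (ha : a ∈ θ.support)
    (hb : b ∈ θ.support) : f (a, b) = 0 := by
  by_contra hne
  have hU : f ⁻¹' {0}ᶜ ∈ nhds (a, b) := hf.continuousAt.preimage_mem_nhds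
    (isOpen_compl_singleton.mem_nhds hne)
  obtain ⟨U, hUa, V, hVb, hUV⟩ := mem_nhds_prod_iff.1 hU
  have hpos : 0 < θ.prod θ (U ×ˢ V) := by
    rw [Measure.prod_prod]
    exact ENNReal.mul_pos ((Measure.mem_support_iff_forall a).1 ha U hUa).ne'
      ((Measure.mem_support_iff_forall b).1 hb V hVb).ne'
  have hle : θ.prod θ (U ×ˢ V) ≤ θ.prod θ {p | ¬ f p = 0} := measure_mono hUV
  rw [ae_iff.1 h0] at hle
  exact hpos.not_ge hle

/-- On a compact space, the support of an image measure is the image of the support. -/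
theorem support_map_eq_image {E E' : Type*} [MetricSpace E] [CompactSpace E] [MeasurableSpace E]
    [BorelSpace E] [MetricSpace E'] [MeasurableSpace E'] [BorelSpace E'] (θ : Measure E)
    {f : E → E'} (hf : Continuous f) : (θ.map f).support = f '' θ.support := by
  apply subset_antisymm
  -- The support is compact, so its image is closed; it also has full measure.
  · refine Measure.support_subset_of_isClosed
      (Measure.isClosed_support.isCompact.image hf).isClosed ?_
    rw [mem_ae_map_iff hf.measurable.aemeasurable
      (Measure.isClosed_support.isCompact.image hf).isClosed.measurableSet]
    exact Filter.mem_of_superset Measure.support_mem_ae (Set.subset_preimage_image _ _)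
  · rintro _ ⟨x, hx, rfl⟩
    rw [Measure.mem_support_iff_forall] at hx ⊢
    intro U hU
    exact (hx _ (hf.continuousAt.preimage_mem_nhds hU)).trans_le
      (Measure.le_map_apply hf.measurable.aemeasurable U)

/-- A coupling of zero cost is induced by an isomorphism if `0 < β < 1`. -/
theorem isomorphic_of_fgwCost_eq_zero [CompactSpace A] {β : ℝ} (hβ0 : 0 < β) (hβ1 : β < 1)
    {𝔛 𝔜 : LabelledMMSpace.{u} A} {π : Measure ((𝔛.carrier × A) × (𝔜.carrier × A))}
    (hπ : π ∈ couplings 𝔛 𝔜) (h0 : fgwCost β 𝔛 𝔜 π = 0) : Isomorphic 𝔛 𝔜 := by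
  obtain ⟨hprob, hfst, hsnd⟩ := hπ
  have hae : fgwIntegrand β 𝔛 𝔜 =ᵐ[π.prod π] 0 :=
    (integral_eq_zero_iff_of_nonneg (fgwIntegrand_nonneg hβ0.le hβ1.le 𝔛 𝔜)
      ((continuous_fgwIntegrand β 𝔛 𝔜).integrable_of_hasCompactSupport
        (HasCompactSupport.of_compactSpace _))).1 h0
  -- Nonnegative terms with sum zero all vanish; strictness of both bounds on `β` allows division by
  -- `1 - β` and `β / 2`.
  have hsplit : ∀ p, fgwIntegrand β 𝔛 𝔜 p = 0 →
      dist p.1.1.1 p.2.1.1 - dist p.1.2.1 p.2.2.1 = 0 ∧ p.1.1.2 = p.1.2.2 := by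
    intro p hp
    have h1 : 0 ≤ (1 - β) * |dist p.1.1.1 p.2.1.1 - dist p.1.2.1 p.2.2.1| ^ 2 := by
      have : 0 ≤ 1 - β := by linarith
      positivity
    have h2 : 0 ≤ β / 2 * dist p.1.1.2 p.1.2.2 ^ 2 := by positivity
    have h3 : 0 ≤ β / 2 * dist p.2.1.2 p.2.2.2 ^ 2 := by positivity
    unfold fgwIntegrand at hp
    have h4 : (1 - β) * |dist p.1.1.1 p.2.1.1 - dist p.1.2.1 p.2.2.1| ^ 2 = 0 := by linarith
    have h5 : β / 2 * dist p.1.1.2 p.1.2.2 ^ 2 = 0 := by linarith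
    have hb : 1 - β ≠ 0 := by linarith
    have hb' : β / 2 ≠ 0 := by positivity
    simpa [hb, hb', hβ0.ne'] using And.intro h4 h5
  -- the labels agree almost surely
  have hlabel : ∀ᵐ q ∂π, q.1.2 = q.2.2 := by
    have h : ∀ᵐ p ∂(π.prod π), p.1.1.2 = p.1.2.2 := by
      filter_upwards [hae] with p hp using (hsplit p hp).2
    have hm : (π.prod π).map Prod.fst = π := by simp
    rw [← hm]
    refine (ae_map_iff measurable_fst.aemeasurable ?_).2 h
    exact (isClosed_eq (by fun_prop) (by fun_prop)).measurableSet
  -- Forgetting labels gives `θ`, whose support will be the graph of the isometry.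
  set pr : (𝔛.carrier × A) × (𝔜.carrier × A) → 𝔛.carrier × 𝔜.carrier :=
    fun q => (q.1.1, q.2.1) with hpr
  have hprc : Continuous pr := by fun_prop
  set θ := π.map pr with hθ
  have hθprob : IsProbabilityMeasure θ := Measure.isProbabilityMeasure_map (by fun_prop)
  have hdist : ∀ a ∈ θ.support, ∀ b ∈ θ.support, dist a.1 b.1 = dist a.2 b.2 := by
    intro a ha b hb
    have hf : Continuous fun p : (𝔛.carrier × 𝔜.carrier) × (𝔛.carrier × 𝔜.carrier) =>
        dist p.1.1 p.2.1 - dist p.1.2 p.2.2 := by fun_prop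
    have hz : ∀ᵐ p ∂(θ.prod θ), dist p.1.1 p.2.1 - dist p.1.2 p.2.2 = 0 := by
      rw [hθ, Measure.map_prod_map _ _ hprc.measurable hprc.measurable]
      refine (ae_map_iff (by fun_prop) (isClosed_eq hf continuous_const).measurableSet).2 ?_
      filter_upwards [hae] with p hp using (hsplit p hp).1
    exact sub_eq_zero.1 (eq_zero_of_mem_support_prod hf hz ha hb)
  have himg1 : 𝔛.structSupport = Prod.fst '' θ.support := by
    rw [← support_map_eq_image θ continuous_fst, structSupport, ← hfst, hθ,
      Measure.map_map (by fun_prop) (by fun_prop), Measure.map_map (by fun_prop) (by fun_prop)]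
    rfl
  have himg2 : 𝔜.structSupport = Prod.snd '' θ.support := by
    rw [← support_map_eq_image θ continuous_snd, structSupport, ← hsnd, hθ,
      Measure.map_map (by fun_prop) (by fun_prop), Measure.map_map (by fun_prop) (by fun_prop)]
    rfl
  -- Both projections are onto by the image formulas and injective because distances agree on the
  -- support.
  let p1 : θ.support → 𝔛.structSupport := fun q => ⟨q.1.1, himg1 ▸ ⟨q.1, q.2, rfl⟩⟩
  let p2 : θ.support → 𝔜.structSupport := fun q => ⟨q.1.2, himg2 ▸ ⟨q.1, q.2, rfl⟩⟩
  have hb1 : Function.Bijective p1 := by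
    constructor
    · rintro ⟨a, ha⟩ ⟨b, hb⟩ hab
      have h1 : a.1 = b.1 := congrArg Subtype.val hab
      have h2 : a.2 = b.2 := by
        rw [← dist_eq_zero, ← hdist a ha b hb, h1, dist_self]
      exact Subtype.ext (Prod.ext h1 h2)
    · rintro ⟨x, hx⟩
      obtain ⟨q, hq, rfl⟩ := himg1 ▸ hx
      exact ⟨⟨q, hq⟩, rfl⟩
  have hb2 : Function.Bijective p2 := by
    constructor
    · rintro ⟨a, ha⟩ ⟨b, hb⟩ hab
      have h2 : a.2 = b.2 := congrArg Subtype.val hab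
      have h1 : a.1 = b.1 := by
        rw [← dist_eq_zero, hdist a ha b hb, h2, dist_self]
      exact Subtype.ext (Prod.ext h1 h2)
    · rintro ⟨x, hx⟩
      obtain ⟨q, hq, rfl⟩ := himg2 ▸ hx
      exact ⟨⟨q, hq⟩, rfl⟩
  let e : 𝔛.structSupport ≃ 𝔜.structSupport :=
    (Equiv.ofBijective p1 hb1).symm.trans (Equiv.ofBijective p2 hb2)
  have he : ∀ q : θ.support, e (p1 q) = p2 q := by
    intro q
    change p2 ((Equiv.ofBijective p1 hb1).symm (Equiv.ofBijective p1 hb1 q)) = p2 q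
    rw [Equiv.symm_apply_apply]
  have hiso : Isometry e := by
    refine Isometry.of_dist_eq fun x y => ?_
    obtain ⟨a, rfl⟩ := hb1.2 x
    obtain ⟨b, rfl⟩ := hb1.2 y
    rw [he, he]
    exact (hdist a a.2 b b.2).symm
  refine ⟨⟨e, hiso⟩, ?_⟩
  have hS : MeasurableSet 𝔛.structSupport := Measure.isClosed_support.measurableSet
  have hS' : MeasurableSet 𝔜.structSupport := Measure.isClosed_support.measurableSet
  have hemb : MeasurableEmbedding
      (Prod.map Subtype.val id : 𝔛.structSupport × A → 𝔛.carrier × A) :=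
    (MeasurableEmbedding.subtype_coe hS).prodMap MeasurableEmbedding.id
  have hemb' : MeasurableEmbedding
      (Prod.map Subtype.val id : 𝔜.structSupport × A → 𝔜.carrier × A) :=
    (MeasurableEmbedding.subtype_coe hS').prodMap MeasurableEmbedding.id
  have hec : Measurable e := hiso.continuous.measurable
  have hsuppπ : ∀ᵐ q ∂π, pr q ∈ θ.support :=
    ae_of_ae_map hprc.measurable.aemeasurable Measure.support_mem_ae
  -- Both measures are marginals of `π`, so it suffices that the two events agree `π`-almost surely.
  ext E hE
  have hm : Measurable (Prod.map e id : 𝔛.structSupport × A → 𝔜.structSupport × A) :=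
    hec.prodMap measurable_id
  change 𝔛.suppMeasure.map (Prod.map e id) E = 𝔜.suppMeasure E
  rw [Measure.map_apply hm hE, suppMeasure, suppMeasure, hemb.comap_apply, hemb'.comap_apply,
    ← hfst, ← hsnd, Measure.map_apply measurable_fst (hemb.measurableSet_image.2 (hm hE)),
    Measure.map_apply measurable_snd (hemb'.measurableSet_image.2 hE)]
  refine measure_congr ?_
  filter_upwards [hlabel, hsuppπ] with q hq hqs
  have h1 : q.1 = Prod.map Subtype.val id (p1 ⟨pr q, hqs⟩, q.1.2) := rfl
  have h2 : q.2 = Prod.map Subtype.val id (p2 ⟨pr q, hqs⟩, q.1.2) := Prod.ext rfl hq.symm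
  change (q.1 ∈ Prod.map Subtype.val id '' _) = (q.2 ∈ Prod.map Subtype.val id '' E)
  rw [h1, h2, hemb.injective.mem_set_image, hemb'.injective.mem_set_image, Set.mem_preimage,
    Prod.map_apply, he]
  rfl

end Isomorphism

end LabelledMMSpace

/-! ### Decomposition of the barycenter objective -/

namespace LabelledMMSpace

section Barycenter

variable {d N : ℕ} {A : Set (EuclideanSpace ℝ (Fin d))} {ρ : Fin N → ℝ}

theorem continuous_labelMean (hA : Convex ℝ A) (hρ : ∀ i, 0 ≤ ρ i) (hsum : ∑ i, ρ i = 1) :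
    Continuous (labelMean hA hρ hsum) := by
  refine Continuous.subtype_mk ?_ _
  fun_prop

theorem continuous_meanMap (hA : Convex ℝ A) (hρ : ∀ i, 0 ≤ ρ i)
    (hsum : ∑ i, ρ i = 1) (𝔛 : Fin N → LabelledMMSpace.{u} A) :
    Continuous (meanMap hA hρ hsum 𝔛) :=
  (MeanSpace.continuous_mk.comp (by fun_prop)).prodMk
    ((continuous_labelMean hA hρ hsum).comp (by fun_prop))

/-- The integrand of the multi-marginal functional. -/
noncomputable def mfgwIntegrand (β : ℝ) (ρ : Fin N → ℝ) (𝔛 : Fin N → LabelledMMSpace.{u} A)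
    (p : (∀ i, (𝔛 i).carrier × A) × (∀ i, (𝔛 i).carrier × A)) : ℝ :=
  (1 - β) * structCost ρ 𝔛 (fun i => (p.1 i).1) (fun i => (p.2 i).1)
    + β / 2 * labelCost ρ (fun i => (p.1 i).2) + β / 2 * labelCost ρ (fun i => (p.2 i).2)

theorem continuous_mfgwIntegrand (β : ℝ) (ρ : Fin N → ℝ) (𝔛 : Fin N → LabelledMMSpace.{u} A) :
    Continuous (mfgwIntegrand β ρ 𝔛) := by
  unfold mfgwIntegrand structCost labelCost
  fun_prop

theorem mfgwCost_eq (β : ℝ) (ρ : Fin N → ℝ) (𝔛 : Fin N → LabelledMMSpace.{u} A)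
    (π : Measure (∀ i, (𝔛 i).carrier × A)) :
    mfgwCost β 𝔛 (structCost ρ 𝔛) (labelCost ρ) π = ∫ p, mfgwIntegrand β ρ 𝔛 p ∂(π.prod π) :=
  rfl

/-- Decomposition of the averaged integrand into the multi-marginal integrand and the integrand
between `𝔜` and the mean space. -/
theorem sum_mul_fgwIntegrand_eq (hA : Convex ℝ A) (hρ : ∀ i, 0 ≤ ρ i) (hsum : ∑ i, ρ i = 1)
    (β : ℝ) (𝔛 : Fin N → LabelledMMSpace.{u} A) (𝔜 : LabelledMMSpace.{u} A)
    (π : Measure (∀ i, (𝔛 i).carrier × A)) [IsProbabilityMeasure π]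
    (p q : (∀ i, (𝔛 i).carrier × A) × (𝔜.carrier × A)) :
    ∑ i, ρ i * fgwIntegrand β (𝔛 i) 𝔜 ((p.1 i, p.2), (q.1 i, q.2))
      = mfgwIntegrand β ρ 𝔛 (p.1, q.1)
        + fgwIntegrand β 𝔜 (meanLabelledSpace hA hρ hsum 𝔛 π)
          ((p.2, meanMap hA hρ hsum 𝔛 p.1), (q.2, meanMap hA hρ hsum 𝔛 q.1)) := by
  -- The variance identity is used once for distances, in `ℝ`, and once for each of the two label
  -- tuples.
  have h1 := sum_mul_norm_sub_sq_eq hsum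
    (fun i => dist (p.1 i).1 (q.1 i).1) (dist p.2.1 q.2.1)
  have h2 := sum_mul_norm_sub_sq_eq hsum
    (fun i => ((p.1 i).2 : EuclideanSpace ℝ (Fin d))) p.2.2
  have h3 := sum_mul_norm_sub_sq_eq hsum
    (fun i => ((q.1 i).2 : EuclideanSpace ℝ (Fin d))) q.2.2
  simp only [Real.norm_eq_abs, smul_eq_mul] at h1
  have h4 : ∑ i, ρ i * fgwIntegrand β (𝔛 i) 𝔜 ((p.1 i, p.2), (q.1 i, q.2))
      = (1 - β) * ∑ i, ρ i * |dist (p.1 i).1 (q.1 i).1 - dist p.2.1 q.2.1| ^ 2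
        + β / 2 * ∑ i, ρ i * ‖((p.1 i).2 : EuclideanSpace ℝ (Fin d)) - p.2.2‖ ^ 2
        + β / 2 * ∑ i, ρ i * ‖((q.1 i).2 : EuclideanSpace ℝ (Fin d)) - q.2.2‖ ^ 2 := by
    simp only [Finset.mul_sum, ← Finset.sum_add_distrib]
    refine Finset.sum_congr rfl fun i _ => ?_
    simp only [fgwIntegrand, Subtype.dist_eq, dist_eq_norm]
    ring
  have h5 : fgwIntegrand β 𝔜 (meanLabelledSpace hA hρ hsum 𝔛 π)
      ((p.2, meanMap hA hρ hsum 𝔛 p.1), (q.2, meanMap hA hρ hsum 𝔛 q.1))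
      = (1 - β) * |dist p.2.1 q.2.1 - ∑ i, ρ i * dist (p.1 i).1 (q.1 i).1| ^ 2
        + β / 2 * ‖(p.2.2 : EuclideanSpace ℝ (Fin d))
            - ∑ i, ρ i • ((p.1 i).2 : EuclideanSpace ℝ (Fin d))‖ ^ 2
        + β / 2 * ‖(q.2.2 : EuclideanSpace ℝ (Fin d))
            - ∑ i, ρ i • ((q.1 i).2 : EuclideanSpace ℝ (Fin d))‖ ^ 2 := by
    rw [← dist_eq_norm, ← dist_eq_norm]
    rfl
  rw [h4, h5, h1, h2, h3, mfgwIntegrand, structCost, labelCost, labelCost]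
  ring

/-- Brings costs of different plans to integrals over one space `γ ⊗ γ`, where pointwise identities
can be integrated. -/
theorem fgwCost_map {Ω : Type*} [MeasurableSpace Ω] {B : Type v} [MetricSpace B]
    [CompactSpace B] [MeasurableSpace B] [BorelSpace B] (β : ℝ) (𝔛 𝔜 : LabelledMMSpace.{u} B)
    (γ : Measure Ω) [IsProbabilityMeasure γ]
    {f : Ω → (𝔛.carrier × B) × (𝔜.carrier × B)} (hf : Measurable f) :
    fgwCost β 𝔛 𝔜 (γ.map f) = ∫ p, fgwIntegrand β 𝔛 𝔜 (f p.1, f p.2) ∂(γ.prod γ) := by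
  rw [fgwCost_eq, Measure.map_prod_map _ _ hf hf, integral_map (hf.prodMap hf).aemeasurable
    (continuous_fgwIntegrand β 𝔛 𝔜).aestronglyMeasurable]
  rfl

/-- Integrated form of the decomposition of the averaged integrand. -/
theorem sum_mul_fgwCost_eq [CompactSpace A] (hA : Convex ℝ A) (hρ : ∀ i, 0 ≤ ρ i)
    (hsum : ∑ i, ρ i = 1) (β : ℝ) (𝔛 : Fin N → LabelledMMSpace.{u} A)
    (𝔜 : LabelledMMSpace.{u} A) (γ : Measure ((∀ i, (𝔛 i).carrier × A) × (𝔜.carrier × A)))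
    [IsProbabilityMeasure γ] (π : Measure (∀ i, (𝔛 i).carrier × A)) [IsProbabilityMeasure π]
    (hπ : γ.map Prod.fst = π) :
    ∑ i, ρ i * fgwCost β (𝔛 i) 𝔜 (γ.map fun p => (p.1 i, p.2))
      = mfgwCost β 𝔛 (structCost ρ 𝔛) (labelCost ρ) π
        + fgwCost β 𝔜 (meanLabelledSpace hA hρ hsum 𝔛 π)
            (γ.map fun p => (p.2, meanMap hA hρ hsum 𝔛 p.1)) := by
  have hmean := continuous_meanMap hA hρ hsum 𝔛
  have hborel : BorelSpace ((∀ i, (𝔛 i).carrier × A) × (𝔜.carrier × A)) := inferInstance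
  have hint : ∀ {g : ((∀ i, (𝔛 i).carrier × A) × (𝔜.carrier × A)) ×
      ((∀ i, (𝔛 i).carrier × A) × (𝔜.carrier × A)) → ℝ}, Continuous g →
      Integrable g (γ.prod γ) := fun hg =>
    hg.integrable_of_hasCompactSupport (HasCompactSupport.of_compactSpace _)
  have hm : mfgwCost β 𝔛 (structCost ρ 𝔛) (labelCost ρ) π
      = ∫ p, mfgwIntegrand β ρ 𝔛 (p.1.1, p.2.1) ∂(γ.prod γ) := by
    rw [mfgwCost_eq, ← hπ, Measure.map_prod_map _ _ measurable_fst measurable_fst,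
      integral_map (by fun_prop) (continuous_mfgwIntegrand β ρ 𝔛).aestronglyMeasurable]
    rfl
  have hf : Continuous fun p : (∀ i, (𝔛 i).carrier × A) × (𝔜.carrier × A) =>
      ((p.2, meanMap hA hρ hsum 𝔛 p.1) :
        (𝔜.carrier × A) × ((meanLabelledSpace hA hρ hsum 𝔛 π).carrier × A)) :=
    continuous_snd.prodMk (hmean.comp continuous_fst)
  have hf' : Measurable fun p : (∀ i, (𝔛 i).carrier × A) × (𝔜.carrier × A) =>
      ((p.2, meanMap hA hρ hsum 𝔛 p.1) :
        (𝔜.carrier × A) × ((meanLabelledSpace hA hρ hsum 𝔛 π).carrier × A)) :=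
    measurable_snd.prodMk ((measurable_meanMap hA hρ hsum 𝔛).comp measurable_fst)
  have hc : ∀ i, fgwCost β (𝔛 i) 𝔜 (γ.map fun p => (p.1 i, p.2))
      = ∫ p, fgwIntegrand β (𝔛 i) 𝔜 ((p.1.1 i, p.1.2), (p.2.1 i, p.2.2)) ∂(γ.prod γ) :=
    fun i => fgwCost_map β (𝔛 i) 𝔜 γ (by fun_prop)
  have hY := fgwCost_map β 𝔜 (meanLabelledSpace hA hρ hsum 𝔛 π) γ hf'
  simp only [hc]
  rw [hm]
  refine Eq.trans ?_ (congrArg _ hY.symm)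
  simp only [← integral_const_mul]
  rw [← integral_finsetSum, ← integral_add]
  · refine integral_congr_ae (Filter.Eventually.of_forall fun p => ?_)
    exact sum_mul_fgwIntegrand_eq hA hρ hsum β 𝔛 𝔜 π p.1 p.2
  · refine hint ?_
    exact (continuous_mfgwIntegrand β ρ 𝔛).comp (by fun_prop)
  · refine hint ?_
    exact (continuous_fgwIntegrand β 𝔜 _).comp
      ((hf.comp continuous_fst).prodMk (hf.comp continuous_snd))
  · intro i _
    refine hint (continuous_const.mul ?_)
    exact (continuous_fgwIntegrand β (𝔛 i) 𝔜).comp (by fun_prop)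

/-! ### Passing between multi-marginal plans and barycenters -/

theorem multiCouplings_nonempty (𝔛 : Fin N → LabelledMMSpace.{u} A) :
    (multiCouplings 𝔛).Nonempty :=
  ⟨Measure.pi fun i => (𝔛 i).μ, inferInstance,
    fun i => (measurePreserving_eval (fun i => (𝔛 i).μ) i).map_eq⟩

/-- The multi-marginal problem has a solution. -/
theorem exists_isMFGWMinimizer [CompactSpace A] (β : ℝ) (ρ : Fin N → ℝ)
    (𝔛 : Fin N → LabelledMMSpace.{u} A) :
    ∃ π, IsMFGWMinimizer β 𝔛 (structCost ρ 𝔛) (labelCost ρ) π := by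
  refine exists_isMinOn_integral_prod_self (continuous_mfgwIntegrand β ρ 𝔛)
    (C := multiCouplings 𝔛) (fun π hπ => hπ.1) ?_ (multiCouplings_nonempty 𝔛)
  have h := isClosed_iInter fun i => ProbabilityMeasure.isClosed_setOf_map_eq
    (E := ∀ i, (𝔛 i).carrier × A) (continuous_apply i) (𝔛 i).μ
  convert h using 1
  ext P
  rw [Set.mem_iInter]
  exact ⟨fun hP => hP.2, fun hP => ⟨inferInstance, hP⟩⟩

/-- The mean space of a multi-marginal plan has at most the cost of the plan. -/
theorem barycenterObjective_meanLabelledSpace_le [CompactSpace A] (hA : Convex ℝ A)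
    (hρ : ∀ i, 0 ≤ ρ i) (hsum : ∑ i, ρ i = 1) {β : ℝ} (hβ0 : 0 ≤ β) (hβ1 : β ≤ 1)
    (𝔛 : Fin N → LabelledMMSpace.{u} A) (π : Measure (∀ i, (𝔛 i).carrier × A))
    [IsProbabilityMeasure π] (hπ : π ∈ multiCouplings 𝔛) :
    barycenterObjective β ρ 𝔛 (meanLabelledSpace hA hρ hsum 𝔛 π)
      ≤ mfgwCost β 𝔛 (structCost ρ 𝔛) (labelCost ρ) π := by
  set 𝔜 := meanLabelledSpace hA hρ hsum 𝔛 π with h𝔜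
  have hmean : Measurable (fun z => meanMap hA hρ hsum 𝔛 z : _ → 𝔜.carrier × A) :=
    measurable_meanMap hA hρ hsum 𝔛
  have hg : Measurable fun z : ∀ i, (𝔛 i).carrier × A =>
      ((z, meanMap hA hρ hsum 𝔛 z) : (∀ i, (𝔛 i).carrier × A) × (𝔜.carrier × A)) :=
    measurable_id.prodMk hmean
  set γ := π.map fun z : ∀ i, (𝔛 i).carrier × A =>
      ((z, meanMap hA hρ hsum 𝔛 z) : (∀ i, (𝔛 i).carrier × A) × (𝔜.carrier × A)) with hγ
  have : IsProbabilityMeasure γ := Measure.isProbabilityMeasure_map hg.aemeasurable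
  have hfst : γ.map Prod.fst = π := by
    rw [hγ, Measure.map_map measurable_fst hg]
    exact Measure.map_id
  have hsnd : γ.map Prod.snd = 𝔜.μ := by
    rw [hγ, Measure.map_map measurable_snd hg]
    rfl
  have hcoup : ∀ i, (γ.map fun p => (p.1 i, p.2)) ∈ couplings (𝔛 i) 𝔜 := by
    intro i
    refine ⟨Measure.isProbabilityMeasure_map (by fun_prop), ?_, ?_⟩
    · have h : (γ.map fun p => (p.1 i, p.2)).map Prod.fst
          = (γ.map Prod.fst).map fun z => z i :=
        (Measure.map_map measurable_fst (by fun_prop)).trans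
          (Measure.map_map (measurable_pi_apply i) measurable_fst).symm
      rw [h, hfst, hπ.2 i]
    · exact (Measure.map_map (by fun_prop) (by fun_prop)).trans hsnd
  -- Since `γ` sits on the graph of `meanMap`, the remainder coupling is concentrated on the
  -- diagonal.
  have hzero : fgwCost β 𝔜 𝔜 (γ.map fun p => (p.2, meanMap hA hρ hsum 𝔛 p.1)) = 0 := by
    have hm2 : Measurable fun p : (∀ i, (𝔛 i).carrier × A) × (𝔜.carrier × A) =>
        ((p.2, meanMap hA hρ hsum 𝔛 p.1) : (𝔜.carrier × A) × (𝔜.carrier × A)) :=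
      measurable_snd.prodMk (hmean.comp measurable_fst)
    have h1 : (γ.map fun p : (∀ i, (𝔛 i).carrier × A) × (𝔜.carrier × A) =>
          ((p.2, meanMap hA hρ hsum 𝔛 p.1) : (𝔜.carrier × A) × (𝔜.carrier × A)))
        = π.map fun z => (meanMap hA hρ hsum 𝔛 z, meanMap hA hρ hsum 𝔛 z) := by
      rw [hγ, Measure.map_map hm2 hg]
      rfl
    refine (congrArg _ h1).trans ?_
    refine (fgwCost_map β 𝔜 𝔜 π (hmean.prodMk hmean)).trans ?_
    simp [fgwIntegrand]
  have h := sum_mul_fgwCost_eq hA hρ hsum β 𝔛 𝔜 γ π hfst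
  have h' := h.trans (congrArg _ hzero)
  rw [add_zero] at h'
  rw [← h', barycenterObjective]
  exact Finset.sum_le_sum fun i _ =>
    mul_le_mul_of_nonneg_left (FGW_sq_le_fgwCost hβ0 hβ1 (hcoup i)) (hρ i)

/-- Gluing optimal plans to `𝔜` gives a multi-marginal plan `π` and a coupling between `𝔜` and the
mean space of `π` which split the barycenter objective. -/
theorem exists_barycenterObjective_eq [CompactSpace A] (hA : Convex ℝ A)
    (hρ : ∀ i, 0 ≤ ρ i) (hsum : ∑ i, ρ i = 1) {β : ℝ} (hβ0 : 0 ≤ β) (hβ1 : β ≤ 1)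
    (𝔛 : Fin N → LabelledMMSpace.{u} A) (𝔜 : LabelledMMSpace.{u} A) :
    ∃ (π : Measure (∀ i, (𝔛 i).carrier × A)) (_ : IsProbabilityMeasure π),
      π ∈ multiCouplings 𝔛 ∧ ∃ σ ∈ couplings 𝔜 (meanLabelledSpace hA hρ hsum 𝔛 π),
        barycenterObjective β ρ 𝔛 𝔜 = mfgwCost β 𝔛 (structCost ρ 𝔛) (labelCost ρ) π
          + fgwCost β 𝔜 (meanLabelledSpace hA hρ hsum 𝔛 π) σ := by
  choose τ hτ hτcost using fun i => exists_mem_couplings_fgwCost_eq hβ0 hβ1 (𝔛 i) 𝔜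
  have hτprob : ∀ i, IsProbabilityMeasure (τ i) := fun i => (hτ i).1
  have hne : ∀ i, Nonempty ((𝔛 i).carrier × A) := fun i => (𝔛 i).μ.nonempty_of_neZero
  obtain ⟨γ, hγ, hγτ⟩ := Measure.exists_glue 𝔜.μ τ fun i => (hτ i).2.2
  have hprob : IsProbabilityMeasure (γ.map Prod.fst) :=
    Measure.isProbabilityMeasure_map measurable_fst.aemeasurable
  have hf : Measurable fun p : (∀ i, (𝔛 i).carrier × A) × (𝔜.carrier × A) =>
      ((p.2, meanMap hA hρ hsum 𝔛 p.1) :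
        (𝔜.carrier × A) × ((meanLabelledSpace hA hρ hsum 𝔛 (γ.map Prod.fst)).carrier × A)) :=
    measurable_snd.prodMk ((measurable_meanMap hA hρ hsum 𝔛).comp measurable_fst)
  refine ⟨γ.map Prod.fst, hprob, ⟨hprob, fun i => ?_⟩,
    γ.map fun p => (p.2, meanMap hA hρ hsum 𝔛 p.1), ⟨?_, ?_, ?_⟩, ?_⟩
  · rw [Measure.map_map (by fun_prop) measurable_fst, ← (hτ i).2.1, ← hγτ i,
      Measure.map_map (by fun_prop) (by fun_prop)]
    rfl
  · exact Measure.isProbabilityMeasure_map hf.aemeasurable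
  · refine (Measure.map_map measurable_fst hf).trans ?_
    -- The law of the `𝔜`-coordinate of `γ` is read off from some `τ i`, so an index is needed;
    -- weights summing to one exclude `N = 0`.
    have hN : Nonempty (Fin N) := by
      by_contra h
      rw [not_nonempty_iff] at h
      simp at hsum
    obtain ⟨i⟩ := hN
    rw [← (hτ i).2.2, ← hγτ i, Measure.map_map (by fun_prop) (by fun_prop)]
    rfl
  · refine (Measure.map_map measurable_snd hf).trans ?_
    exact (Measure.map_map (measurable_meanMap hA hρ hsum 𝔛) measurable_fst).symm
  · refine Eq.trans ?_ (sum_mul_fgwCost_eq hA hρ hsum β 𝔛 𝔜 γ _ rfl)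
    refine Finset.sum_congr rfl fun i _ => ?_
    rw [hγτ i, hτcost i]

end Barycenter

end LabelledMMSpace

/-! ### Conclusion -/

theorem mainTheorem4 {d N : ℕ} (A : Set (EuclideanSpace ℝ (Fin d)))
    (hAcompact : IsCompact A) (hAconvex : Convex ℝ A)
    (𝔛 : Fin N → LabelledMMSpace.{u} A)
    (ρ : Fin N → ℝ) (hρ : ∀ i, 0 ≤ ρ i) (hsum : ∑ i, ρ i = 1)
    (β : ℝ) (hβ0 : 0 ≤ β) (hβ1 : β ≤ 1) :
    (∃ 𝔜 : LabelledMMSpace.{u} A, LabelledMMSpace.IsFusedBarycenter β ρ 𝔛 𝔜) ∧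
    (∀ 𝔜 : LabelledMMSpace.{u} A, LabelledMMSpace.IsFusedBarycenter β ρ 𝔛 𝔜 →
      ∃ (π : Measure (∀ i, (𝔛 i).carrier × A)) (_ : IsProbabilityMeasure π),
        LabelledMMSpace.IsMFGWMinimizer β 𝔛
          (LabelledMMSpace.structCost ρ 𝔛) (LabelledMMSpace.labelCost ρ) π ∧
        LabelledMMSpace.FGW β 𝔜
          (LabelledMMSpace.meanLabelledSpace hAconvex hρ hsum 𝔛 π) = 0 ∧
        (0 < β → β < 1 → LabelledMMSpace.Isomorphic 𝔜
          (LabelledMMSpace.meanLabelledSpace hAconvex hρ hsum 𝔛 π))) := by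
  have : CompactSpace A := isCompact_iff_compactSpace.1 hAcompact
  obtain ⟨π₀, hπ₀, hmin⟩ := LabelledMMSpace.exists_isMFGWMinimizer β ρ 𝔛
  have := hπ₀.1
  have hle := LabelledMMSpace.barycenterObjective_meanLabelledSpace_le hAconvex hρ hsum hβ0 hβ1
    𝔛 π₀ hπ₀
  constructor
  · refine ⟨LabelledMMSpace.meanLabelledSpace hAconvex hρ hsum 𝔛 π₀, fun 𝔷 => hle.trans ?_⟩
    obtain ⟨π, hπ, hπmem, σ, -, heq⟩ :=
      LabelledMMSpace.exists_barycenterObjective_eq hAconvex hρ hsum hβ0 hβ1 𝔛 𝔷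
    rw [heq]
    exact (hmin hπmem).trans (le_add_of_nonneg_right (LabelledMMSpace.fgwCost_nonneg hβ0 hβ1 _ _ _))
  · intro 𝔜 h𝔜
    obtain ⟨π, hπ, hπmem, σ, hσ, heq⟩ :=
      LabelledMMSpace.exists_barycenterObjective_eq hAconvex hρ hsum hβ0 hβ1 𝔛 𝔜
    have hnonneg := LabelledMMSpace.fgwCost_nonneg hβ0 hβ1 𝔜
      (LabelledMMSpace.meanLabelledSpace hAconvex hρ hsum 𝔛 π) σ
    -- Sandwich: cost of `π` plus remainder is the objective of `𝔜`, at most the cost of `π₀`, hence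
    -- at most the cost of `π`. So the remainder is zero and `π` is a minimizer too.
    have hupper := (h𝔜 _).trans hle
    have hlower := isMinOn_iff.1 hmin π hπmem
    have hzero : LabelledMMSpace.fgwCost β 𝔜
        (LabelledMMSpace.meanLabelledSpace hAconvex hρ hsum 𝔛 π) σ = 0 := by linarith
    refine ⟨π, hπ, ⟨hπmem, isMinOn_iff.2 fun π' hπ' => ?_⟩, ?_, fun h0 h1 =>
      LabelledMMSpace.isomorphic_of_fgwCost_eq_zero h0 h1 hσ hzero⟩
    · have := isMinOn_iff.1 hmin π' hπ'
      linarith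
    · have h := LabelledMMSpace.FGW_sq_le_fgwCost hβ0 hβ1 hσ
      rw [hzero] at h
      exact pow_eq_zero_iff two_ne_zero |>.1 (le_antisymm h (sq_nonneg _))
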